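/- There are absolute constants $c, C > 0$ such that the following holds. Let $1 \le \ell \le d$ and $k$ be integers and let $\varepsilon > 0$ satisfy $k \ge c\,(d + 1/\varepsilon^2)$. Let $D \in \mathbb{R}^{d\times d}$ be symmetric (not necessarily positive semidefinite) with Frobenius norm $\|D\|_F \le 1$ and $\lambda_\ell(D) \ge 0$, where $\lambda_\ell(\cdot)$ denotes the $\ell$-th largest eigenvalue of a symmetric matrix, counted with multiplicity. Let $G \in \mathbb{R}^{k\times d}$ be a random matrix with i.i.d. $\mathcal{N}(0,1/k)$ entries. Then $k \ge \ell$, so that $\lambda_\ell(GDG^T)$ is defined, and with probability at least $1 - \frac{1}{20}\,2^{-\min(\ell,\,\varepsilon^{-2})}$, \[ \lambda_\ell(GDG^T) \le \lambda_\ell(D) + C\varepsilon . \] -/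

import Mathlib

open MeasureTheory ProbabilityTheory
open scoped NNReal Matrix

noncomputable section

namespace SketchedEig

open scoped Matrix.Norms.Frobenius in
/-- The Frobenius norm of a real matrix. -/
def frobNorm {m n : ℕ} (A : Matrix (Fin m) (Fin n) ℝ) : ℝ := ‖A‖

/-- The `ℓ`-th largest eigenvalue `λ_ℓ(A)` of a real symmetric `n × n` matrix, counted with
multiplicity, for `1 ≤ ℓ ≤ n` (Mathlib's `eigenvalues₀` is the list in decreasing order,
indexed from `0`). -/
def eig {n : ℕ} {A : Matrix (Fin n) (Fin n) ℝ} (hA : A.IsHermitian) (ℓ : ℕ)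
    (h1 : 1 ≤ ℓ) (hn : ℓ ≤ n) : ℝ :=
  hA.eigenvalues₀ ⟨ℓ - 1, by rw [Fintype.card_fin]; omega⟩

/-- `G D Gᵀ` is symmetric when `D` is. -/
theorem isHermitian_sketch {k d : ℕ} (G : Matrix (Fin k) (Fin d) ℝ)
    {D : Matrix (Fin d) (Fin d) ℝ} (hD : D.IsHermitian) : (G * D * Gᵀ).IsHermitian := by
  have h := Matrix.isHermitian_mul_mul_conjTranspose G hD
  rwa [Matrix.conjTranspose_eq_transpose_of_trivial] at h

/-- The random `k × d` matrix `G` has i.i.d. `N(0, 1/k)` entries. -/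
structure IsGaussianSketch {Ω : Type*} [MeasurableSpace Ω] (P : Measure Ω) {k d : ℕ}
    (G : Ω → Matrix (Fin k) (Fin d) ℝ) : Prop where
  law : ∀ i j, HasLaw (fun ω => G ω i j) (gaussianReal 0 (1 / (k : ℝ≥0))) P
  indep : iIndepFun (fun (p : Fin k × Fin d) ω => G ω p.1 p.2) P

end SketchedEig

end

namespace SketchedEig

/-! ### Gaussian quadratic forms -/

/-! By rotation invariance (`mul_orthogonal`) `D` may be taken diagonal in an eigenbasis, with `H =
G U` again Gaussian. Testing `G D Gᵀ` only on vectors orthogonal to the `ℓ - 1` columns of `H` with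
the largest eigenvalues, and discarding negative eigenvalues, leaves weights `0 ≤ σ j ≤ lam =
λ_ℓ(D)` (`eig_sketch_le`). It remains to show that `H` with columns scaled by `√σ j` has squared
operator norm `lam + O(1/√k)` (`weighted_bound`).

A direct net bound over all `d` columns would lose a factor `√(d/k)` times `lam`, which is too much.
The columns are therefore split at weight `lam / 16`. Since `∑ σ j ^ 2 ≤ 1`, at most `256 / lam²`
weights are large, and `ℓ * lam² ≤ 1` as well; hence the distortion of the large columns, of order
`√((|J| + ℓ)/k)`, costs only `O(1/√k)` after multiplication by `lam` (`near_isometry`). The small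
columns need only a crude constant bound, because their weights leave room below `lam`. The cross
term is controlled by conditioning on the large columns: the correlations with the small ones are
then independent Gaussians, and a Chernoff bound with a net gives size `O(√d / k)` (`cross_bound`).
`weighted_norm_sq_le` combines the three estimates, and each fails with probability at most
`2^{-ℓ}/60`. -/

/-- `(1 - 2x)⁻¹ ≤ exp (2x + 4x²)` for `|x| ≤ 1/4`. -/
theorem inv_one_sub_le_exp {x : ℝ} (hx : |x| ≤ 1 / 4) :
    (1 - 2 * x)⁻¹ ≤ Real.exp (2 * (x + 2 * x ^ 2)) := by
  obtain ⟨h1, h2⟩ := abs_le.1 hx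
  have hpos : 0 < 1 - 2 * x := by linarith
  rw [inv_le_iff_one_le_mul₀ hpos]
  rcases le_total 0 x with h0 | h0
  -- The linear bound `1 + s ≤ exp s` gives `(1 + 2x + 4x²)(1 - 2x) = 1 - 8x³`, which suffices only
  -- for `x ≤ 0`; for positive `x` the quadratic term is needed.
  · have h := Real.quadratic_le_exp_of_nonneg (x := 2 * (x + 2 * x ^ 2)) (by positivity)
    have h3 : 1 ≤ (1 + 2 * (x + 2 * x ^ 2) + (2 * (x + 2 * x ^ 2)) ^ 2 / 2) * (1 - 2 * x) := by
      have h4 : 0 ≤ (1 - 4 * x ^ 2) * (1 + 2 * x) / 2 - 2 * x := by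
        nlinarith [mul_nonneg h0 h0, mul_nonneg h0 (sub_nonneg.2 h2),
          mul_nonneg (mul_nonneg h0 h0) (sub_nonneg.2 h2)]
      nlinarith [mul_nonneg (sq_nonneg x) h4]
    nlinarith
  · have h := Real.add_one_le_exp (2 * (x + 2 * x ^ 2))
    have h3 : 1 ≤ (2 * (x + 2 * x ^ 2) + 1) * (1 - 2 * x) := by
      nlinarith [mul_nonneg (sq_nonneg x) (neg_nonneg.2 h0)]
    nlinarith

/-- The exponential moment of a Gaussian square: it is positive, and bounded as for a
sub-exponential variable. -/
theorem integral_exp_sq_gaussianReal (v : ℝ≥0) {a : ℝ} (ha : |a * v| ≤ 1 / 4) :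
    0 < ∫ x, Real.exp (a * x ^ 2) ∂(gaussianReal 0 v) ∧
      ∫ x, Real.exp (a * x ^ 2) ∂(gaussianReal 0 v) ≤ Real.exp (a * v + 2 * (a * v) ^ 2) := by
  rcases eq_or_ne v 0 with rfl | hv
  · simp
  have hv' : 0 < (v : ℝ) := by positivity
  obtain ⟨h1, h2⟩ := abs_le.1 ha
  have hb : 0 < 1 - 2 * (a * v) := by linarith
  have key : ∫ x, Real.exp (a * x ^ 2) ∂(gaussianReal 0 v) = √((1 - 2 * (a * v))⁻¹) := by
    rw [integral_gaussianReal_eq_integral_smul hv]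
    have h3 : ∀ x : ℝ, gaussianPDFReal 0 v x • Real.exp (a * x ^ 2)
        = (√(2 * Real.pi * v))⁻¹ * Real.exp (-((1 - 2 * (a * v)) / (2 * v)) * x ^ 2) := by
      intro x
      rw [gaussianPDFReal_def, smul_eq_mul, mul_assoc, ← Real.exp_add]
      congr 2
      field_simp
      ring
    simp_rw [h3]
    rw [integral_const_mul, integral_gaussian, ← Real.sqrt_inv, ← Real.sqrt_mul (by positivity)]
    congr 1
    have := Real.pi_pos
    field_simp
  rw [key]
  refine ⟨Real.sqrt_pos.2 (by positivity), ?_⟩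
  rw [Real.sqrt_le_left (by positivity)]
  refine (inv_one_sub_le_exp ha).trans (le_of_eq ?_)
  rw [← Real.exp_nat_mul]
  norm_num

/-- Chernoff bound for a diagonal quadratic form in independent centred Gaussian variables. -/
theorem measureReal_le_sum_mul_sq_le {Ω ι : Type*} [MeasurableSpace Ω] [Fintype ι]
    {P : Measure Ω} [IsProbabilityMeasure P] {X : ι → Ω → ℝ} {v : ℝ≥0}
    (hlaw : ∀ i, HasLaw (X i) (gaussianReal 0 v) P) (hind : iIndepFun X P) (a : ι → ℝ)
    (ha : ∀ i, |a i * v| ≤ 1 / 4) (T : ℝ) :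
    P.real {ω | T ≤ ∑ i, a i * X i ω ^ 2} ≤
      Real.exp (∑ i, (a i * v + 2 * (a i * v) ^ 2) - T) := by
  have hm : ∀ i, AEMeasurable (fun ω => a i * X i ω ^ 2) P :=
    fun i => ((hlaw i).aemeasurable.pow_const 2).const_mul _
  have hind' : iIndepFun (fun i ω => a i * X i ω ^ 2) P :=
    hind.comp (fun i x => a i * x ^ 2) (fun i => by fun_prop)
  have hmgf : ∀ i, mgf (fun ω => a i * X i ω ^ 2) P 1
      = ∫ x, Real.exp (a i * x ^ 2) ∂(gaussianReal 0 v) := by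
    intro i
    rw [← (hlaw i).map_eq, integral_map (hlaw i).aemeasurable (by fun_prop)]
    simp [mgf]
  have hsum := hind'.mgf_sum₀ hm Finset.univ (t := 1)
  have hpos : 0 < mgf (∑ i, fun ω => a i * X i ω ^ 2) P 1 := by
    rw [hsum]
    exact Finset.prod_pos fun i _ => by
      rw [hmgf]; exact (integral_exp_sq_gaussianReal v (ha i)).1
  -- The Bochner integral of a non-integrable function is `0`, so a positive moment generating
  -- function already forces integrability.
  have hint : Integrable (fun ω => Real.exp (1 * (∑ i, fun ω => a i * X i ω ^ 2) ω)) P := by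
    by_contra h
    exact hpos.ne' (integral_undef h)
  have h := measure_ge_le_exp_mul_mgf T zero_le_one hint
  rw [hsum] at h
  have hprod : ∏ i, mgf (fun ω => a i * X i ω ^ 2) P 1
      ≤ Real.exp (∑ i, (a i * v + 2 * (a i * v) ^ 2)) := by
    rw [Real.exp_sum]
    refine Finset.prod_le_prod (fun i _ => mgf_nonneg) fun i _ => ?_
    rw [hmgf]
    exact (integral_exp_sq_gaussianReal v (ha i)).2
  calc P.real {ω | T ≤ ∑ i, a i * X i ω ^ 2}
      = P.real {ω | T ≤ (∑ i, fun ω => a i * X i ω ^ 2) ω} := by simp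
    _ ≤ _ := h
    _ ≤ Real.exp (-1 * T) * Real.exp (∑ i, (a i * v + 2 * (a i * v) ^ 2)) := by gcongr
    _ = _ := by rw [← Real.exp_add]; congr 1; ring

/-- A bound that holds conditionally on each value of `X` holds for the pair `(X, Y)` of
independent variables. -/
theorem measureReal_pair_le_of_indepFun {Ω α β : Type*} [MeasurableSpace Ω] [MeasurableSpace α]
    [MeasurableSpace β] {P : Measure Ω} [IsProbabilityMeasure P] {X : Ω → α} {Y : Ω → β}
    (hX : AEMeasurable X P) (hY : AEMeasurable Y P) (hXY : IndepFun X Y P) {K : Set (α × β)}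
    (hK : MeasurableSet K) {b : ℝ} (hb : 0 ≤ b) (h : ∀ x, P.real {ω | (x, Y ω) ∈ K} ≤ b) :
    P.real {ω | (X ω, Y ω) ∈ K} ≤ b := by
  have : IsProbabilityMeasure (P.map X) := Measure.isProbabilityMeasure_map hX
  have : IsProbabilityMeasure (P.map Y) := Measure.isProbabilityMeasure_map hY
  refine ENNReal.toReal_le_of_le_ofReal hb ?_
  have h1 : P {ω | (X ω, Y ω) ∈ K} = P.map (fun ω => (X ω, Y ω)) K :=
    (Measure.map_apply_of_aemeasurable (hX.prodMk hY) hK).symm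
  rw [h1, hXY.map_prod_eq_prod_map_map hX hY, Measure.prod_apply hK]
  calc ∫⁻ x, P.map Y (Prod.mk x ⁻¹' K) ∂(P.map X)
      ≤ ∫⁻ _, ENNReal.ofReal b ∂(P.map X) := by
        refine lintegral_mono fun x => ?_
        rw [Measure.map_apply_of_aemeasurable hY (measurable_prodMk_left hK)]
        exact (ENNReal.le_ofReal_iff_toReal_le (measure_ne_top _ _) hb).2 (h x)
    _ = ENNReal.ofReal b := by simp

/-- Linear functionals of a Gaussian matrix with orthogonal coefficient arrays of common squared
norm `r` are independent centred Gaussian variables of variance `r / k`. -/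
theorem IsGaussianSketch.linear {Ω ι : Type*} [MeasurableSpace Ω] [Fintype ι] [DecidableEq ι]
    {P : Measure Ω} [IsProbabilityMeasure P] {k d : ℕ} {G : Ω → Matrix (Fin k) (Fin d) ℝ}
    (hG : IsGaussianSketch P G) (M : ι → Fin k → Fin d → ℝ) (r : ℝ≥0)
    (hM : ∀ p q, ∑ i, ∑ j, M p i j * M q i j = if p = q then (r : ℝ) else 0) :
    (∀ p, HasLaw (fun ω => ∑ i, ∑ j, M p i j * G ω i j) (gaussianReal 0 (r * (1 / (k : ℝ≥0)))) P) ∧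
      iIndepFun (fun p ω => ∑ i, ∑ j, M p i j * G ω i j) P := by
  set g : Fin k × Fin d → Ω → ℝ := fun e ω => G ω e.1 e.2 with hg
  have hlaw : ∀ e, HasLaw (g e) (gaussianReal 0 (1 / (k : ℝ≥0))) P := fun e => hG.law e.1 e.2
  have hgauss : HasGaussianLaw (fun ω => (g · ω)) P :=
    iIndepFun.hasGaussianLaw (fun e => (hlaw e).hasGaussianLaw) hG.indep
  have hL2 : ∀ e, MemLp (g e) 2 P := fun e => (hlaw e).hasGaussianLaw.memLp_two
  have hcov : ∀ e f, cov[g e, g f; P] = if e = f then ((1 / (k : ℝ≥0) : ℝ≥0) : ℝ) else 0 := by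
    intro e f
    split_ifs with hef
    · subst hef
      rw [covariance_self (hlaw e).aemeasurable, (hlaw e).variance_eq, variance_id_gaussianReal]
    · exact (hG.indep.indepFun hef).covariance_eq_zero (hL2 e) (hL2 f)
  set Y : ι → Ω → ℝ := fun p ω => ∑ e : Fin k × Fin d, M p e.1 e.2 * g e ω with hY
  have hYeq : (fun p ω => ∑ i, ∑ j, M p i j * G ω i j) = Y := by
    ext p ω
    simp [hY, hg, Fintype.sum_prod_type]
  -- A linear image of a Gaussian vector is jointly Gaussian, so independence reduces to vanishing
  -- covariances.
  have hYgauss : HasGaussianLaw (fun ω => (Y · ω)) P :=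
    hgauss.map_fun (ContinuousLinearMap.pi fun p =>
      ∑ e : Fin k × Fin d, M p e.1 e.2 • ContinuousLinearMap.proj e) |>.congr
        (Filter.Eventually.of_forall fun ω => by ext p; simp [hY])
  have hYcov : ∀ p q, cov[Y p, Y q; P] = (if p = q then (r : ℝ) else 0) *
      ((1 / (k : ℝ≥0) : ℝ≥0) : ℝ) := by
    intro p q
    rw [hY, covariance_fun_sum_fun_sum (fun e => (hL2 e).const_mul _)
      (fun e => (hL2 e).const_mul _)]
    simp_rw [covariance_const_mul_left, covariance_const_mul_right, hcov]
    rw [← hM p q]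
    simp [Fintype.sum_prod_type, Finset.sum_mul, mul_assoc]
  have hYmean : ∀ p, P[Y p] = 0 := by
    intro p
    rw [hY, integral_finsetSum _ fun e _ => ((hL2 e).integrable one_le_two).const_mul _]
    refine Finset.sum_eq_zero fun e _ => ?_
    rw [integral_const_mul, (hlaw e).integral_eq, integral_id_gaussianReal, mul_zero]
  have hone : ∀ p, HasGaussianLaw (Y p) P := fun p => hYgauss.eval p
  refine ⟨fun p => ?_, ?_⟩
  · have : (fun ω => ∑ i, ∑ j, M p i j * G ω i j) = Y p := congrFun hYeq p
    rw [this]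
    refine ⟨(hone p).aemeasurable, ?_⟩
    rw [(hone p).map_eq_gaussianReal, hYmean, ← covariance_self (hone p).aemeasurable, hYcov,
      if_pos rfl, ← NNReal.coe_mul, Real.toNNReal_coe]
  · rw [hYeq]
    exact hYgauss.iIndepFun_of_covariance_eq_zero fun p q hpq => by rw [hYcov, if_neg hpq, zero_mul]

end SketchedEig

namespace SketchedEig

/-! ### Nets on the unit sphere -/

section Net

variable {E F : Type*} [NormedAddCommGroup E] [InnerProductSpace ℝ E] [FiniteDimensional ℝ E]
  [NormedAddCommGroup F] [InnerProductSpace ℝ F]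

/-- The unit sphere of a Euclidean space has a `1/2`-net of at most `5 ^ dim` unit vectors. -/
theorem exists_finset_net (E : Type*) [NormedAddCommGroup E] [InnerProductSpace ℝ E]
    [FiniteDimensional ℝ E] :
    ∃ N : Finset E, N.card ≤ 5 ^ Module.finrank ℝ E ∧ (∀ w ∈ N, ‖w‖ = 1) ∧
      ∀ u : E, ‖u‖ = 1 → ∃ w ∈ N, ‖u - w‖ ≤ 1 / 2 := by
  classical
  let Sep : Finset E → Prop := fun N => (∀ w ∈ N, ‖w‖ = 1) ∧
    ∀ c ∈ N, ∀ e ∈ N, c ≠ e → 1 / 2 ≤ ‖c - e‖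
  have hcard : ∀ N, Sep N → N.card ≤ 5 ^ Module.finrank ℝ E := by
    intro N hN
    -- After doubling, a `1/2`-separated set of unit vectors is `1`-separated in the ball of radius
    -- `2`, the normalization of the `5 ^ dim` packing bound. A separated set of maximal cardinality
    -- is then a net.
    have hinj : Function.Injective fun w : E => (2 : ℝ) • w :=
      smul_right_injective E two_ne_zero
    rw [← Finset.card_image_of_injective N hinj]
    apply Besicovitch.card_le_of_separated
    · intro c hc
      obtain ⟨w, hw, rfl⟩ := Finset.mem_image.1 hc
      simp [norm_smul, hN.1 w hw]
    · intro c hc e he hce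
      obtain ⟨w, hw, rfl⟩ := Finset.mem_image.1 hc
      obtain ⟨z, hz, rfl⟩ := Finset.mem_image.1 he
      have := hN.2 w hw z hz (fun h => hce (by rw [h]))
      rw [← smul_sub, norm_smul, Real.norm_ofNat]
      linarith
  let S : Set ℕ := {n | ∃ N, Sep N ∧ N.card = n}
  have hS : S.Nonempty := ⟨0, ∅, by simp [Sep], rfl⟩
  have hSb : BddAbove S := ⟨5 ^ Module.finrank ℝ E, by rintro _ ⟨N, hN, rfl⟩; exact hcard N hN⟩
  obtain ⟨N, hN, hmax⟩ := Nat.sSup_mem hS hSb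
  refine ⟨N, hcard N hN, hN.1, fun u hu => ?_⟩
  by_contra! hfar
  have hu' : u ∉ N := fun h => by
    have := hfar u h
    rw [sub_self, norm_zero] at this
    linarith
  have hsep : Sep (insert u N) := by
    refine ⟨fun w hw => ?_, fun c hc e he hce => ?_⟩
    · rcases Finset.mem_insert.1 hw with rfl | hw
      exacts [hu, hN.1 w hw]
    · rcases Finset.mem_insert.1 hc with hcu | hc <;> rcases Finset.mem_insert.1 he with heu | he
      · exact absurd (hcu.trans heu.symm) hce
      · rw [hcu]; exact (hfar e he).le
      · rw [heu, norm_sub_rev]; exact (hfar c hc).le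
      · exact hN.2 c hc e he hce
  have h := le_csSup hSb (⟨_, hsep, rfl⟩ : (insert u N).card ∈ S)
  rw [Finset.card_insert_of_notMem hu'] at h
  omega

/-- A continuous function on a Euclidean space that is homogeneous of degree two is dominated by
its value at some unit vector, unless the space is trivial. -/
theorem exists_unit_forall_le {q : E → ℝ} (hq : Continuous q)
    (hhom : ∀ (c : ℝ) u, q (c • u) = c ^ 2 * q u) :
    (∀ u, q u = 0 ∧ u = 0) ∨ ∃ u₀, ‖u₀‖ = 1 ∧ ∀ u, q u ≤ q u₀ * ‖u‖ ^ 2 := by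
  have h0 : q 0 = 0 := by simpa using hhom 0 0
  rcases subsingleton_or_nontrivial E with hE | hE
  · left
    intro u
    rw [Subsingleton.elim u 0]
    exact ⟨h0, rfl⟩
  right
  obtain ⟨u₀, hu₀, hmax⟩ := (isCompact_sphere (0 : E) 1).exists_isMaxOn
    (NormedSpace.sphere_nonempty.2 zero_le_one) hq.continuousOn
  have hu₀' : ‖u₀‖ = 1 := by simpa using hu₀
  refine ⟨u₀, hu₀', fun u => ?_⟩
  rcases eq_or_ne u 0 with rfl | hu
  · simp [h0]
  have hn : ‖u‖ ≠ 0 := norm_ne_zero_iff.2 hu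
  have h1 : q (‖u‖⁻¹ • u) ≤ q u₀ := hmax (by simp [norm_smul, hn])
  calc q u = ‖u‖ ^ 2 * q (‖u‖⁻¹ • u) := by rw [hhom]; field_simp
    _ ≤ ‖u‖ ^ 2 * q u₀ := by gcongr
    _ = _ := mul_comm _ _

/-- A polarization identity for the difference of two squared norms. -/
theorem norm_sq_polar {V : Type*} [NormedAddCommGroup V] [InnerProductSpace ℝ V] (z z' : V) :
    ‖(2 : ℝ) • (z - z') + (1 / 2 : ℝ) • (z + z')‖ ^ 2
      - ‖(2 : ℝ) • (z - z') - (1 / 2 : ℝ) • (z + z')‖ ^ 2 = 4 * (‖z‖ ^ 2 - ‖z'‖ ^ 2) := by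
  rw [norm_add_sq_real, norm_sub_sq_real, real_inner_smul_left, real_inner_smul_right,
    inner_sub_left, inner_add_right, inner_add_right, real_inner_self_eq_norm_sq,
    real_inner_self_eq_norm_sq, real_inner_comm z z']
  ring

/-- Near-isometry on a `1/2`-net of the sphere implies near-isometry. -/
theorem abs_norm_sq_sub_le_of_net {N : Finset E} (hN1 : ∀ w ∈ N, ‖w‖ = 1)
    (hN : ∀ u : E, ‖u‖ = 1 → ∃ w ∈ N, ‖u - w‖ ≤ 1 / 2) (A : E →ₗ[ℝ] F) {τ : ℝ}
    (hτ : ∀ w ∈ N, |‖A w‖ ^ 2 - 1| ≤ τ) (u : E) :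
    |‖A u‖ ^ 2 - ‖u‖ ^ 2| ≤ 32 * τ * ‖u‖ ^ 2 := by
  have hA : Continuous A := A.continuous_of_finiteDimensional
  rcases exists_unit_forall_le (q := fun u => |‖A u‖ ^ 2 - ‖u‖ ^ 2|) (by fun_prop)
    (fun c u => by
      rw [map_smul, norm_smul, norm_smul, mul_pow, mul_pow, ← mul_sub, abs_mul]
      simp) with h | ⟨u₀, hu₀, hmax⟩
  · simp [(h u).2]
  set M := |‖A u₀‖ ^ 2 - ‖u₀‖ ^ 2| with hM
  obtain ⟨w, hw, hd⟩ := hN u₀ hu₀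
  have hw1 := hN1 w hw
  have hM0 : 0 ≤ M := abs_nonneg _
  -- The factors `2` and `1/2` balance the polarization: `‖u₀ - w‖ ≤ 1/2` and `‖u₀ + w‖ ≤ 2` become
  -- norms at most `1`. The parallelogram law then gives the contraction factor `31/32`, hence the
  -- constant `32`; without rescaling there is no contraction.
  set x := (2 : ℝ) • (u₀ - w) with hx
  set y := (1 / 2 : ℝ) • (u₀ + w) with hy
  have hpolar : (‖A u₀‖ ^ 2 - ‖u₀‖ ^ 2) - (‖A w‖ ^ 2 - 1)
      = ((‖A (x + y)‖ ^ 2 - ‖x + y‖ ^ 2) - (‖A (x - y)‖ ^ 2 - ‖x - y‖ ^ 2)) / 4 := by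
    have e1 : ‖w‖ ^ 2 = 1 := by rw [hw1]; norm_num
    have h3 := norm_sq_polar (A u₀) (A w)
    have h4 := norm_sq_polar u₀ w
    rw [← map_sub, ← map_add, ← map_smul, ← map_smul, ← map_add, ← map_sub] at h3
    rw [← hx, ← hy] at h3 h4
    linarith
  have hpar : ‖x + y‖ ^ 2 + ‖x - y‖ ^ 2 ≤ 31 / 8 := by
    have h1 : ‖x + y‖ ^ 2 + ‖x - y‖ ^ 2 = 2 * ‖x‖ ^ 2 + 2 * ‖y‖ ^ 2 := by
      rw [norm_add_sq_real, norm_sub_sq_real]; ring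
    have h2 : ‖u₀ + w‖ ^ 2 = 4 - ‖u₀ - w‖ ^ 2 := by
      rw [norm_add_sq_real, norm_sub_sq_real, hu₀, hw1]; ring
    have h3 : ‖u₀ - w‖ ^ 2 ≤ 1 / 4 := by nlinarith [norm_nonneg (u₀ - w)]
    rw [h1, hx, hy, norm_smul, norm_smul, mul_pow, mul_pow, h2]
    norm_num
    linarith
  have h1 := abs_le.1 (hmax (x + y))
  have h2 := abs_le.1 (hmax (x - y))
  have h3 := abs_le.1 (hτ w hw)
  have h4 : M * (‖x + y‖ ^ 2 + ‖x - y‖ ^ 2) ≤ M * (31 / 8) := by gcongr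
  have hMle : M ≤ τ + 31 / 32 * M := by
    rw [hM, abs_le]
    constructor <;> linarith [h1.1, h1.2, h2.1, h2.2, h3.1, h3.2]
  refine (hmax u).trans ?_
  gcongr
  linarith

/-- A linear map bounded on a `1/2`-net of the sphere is bounded. -/
theorem norm_sq_le_of_net {N : Finset E} (hN : ∀ u : E, ‖u‖ = 1 → ∃ w ∈ N, ‖u - w‖ ≤ 1 / 2)
    (S : E →ₗ[ℝ] F) {T : ℝ} (hT : ∀ w ∈ N, ‖S w‖ ^ 2 ≤ T) (u : E) :
    ‖S u‖ ^ 2 ≤ 4 * T * ‖u‖ ^ 2 := by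
  have hS : Continuous S := S.continuous_of_finiteDimensional
  rcases exists_unit_forall_le (q := fun u => ‖S u‖ ^ 2) (by fun_prop)
    (fun c u => by rw [map_smul, norm_smul, mul_pow]; simp) with h | ⟨u₀, hu₀, hmax⟩
  · simp [(h u).2]
  obtain ⟨w, hw, hd⟩ := hN u₀ hu₀
  have h1 : ‖S (u₀ - w)‖ ≤ ‖S u₀‖ * (1 / 2) := by
    refine (abs_le_of_sq_le_sq' ?_ (by positivity)).2
    calc ‖S (u₀ - w)‖ ^ 2 ≤ ‖S u₀‖ ^ 2 * ‖u₀ - w‖ ^ 2 := hmax _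
      _ ≤ ‖S u₀‖ ^ 2 * (1 / 2) ^ 2 := by gcongr
      _ = _ := by ring
  have h2 : ‖S u₀‖ ≤ ‖S (u₀ - w)‖ + ‖S w‖ := by
    calc ‖S u₀‖ = ‖S (u₀ - w) + S w‖ := by rw [← map_add, sub_add_cancel]
      _ ≤ _ := norm_add_le _ _
  have h3 : ‖S u₀‖ ≤ 2 * ‖S w‖ := by linarith
  refine (hmax u).trans ?_
  gcongr
  calc ‖S u₀‖ ^ 2 ≤ (2 * ‖S w‖) ^ 2 := by gcongr
    _ = 4 * ‖S w‖ ^ 2 := by ring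
    _ ≤ _ := by linarith [hT w hw]

end Net

end SketchedEig

namespace SketchedEig

/-! ### Columns of a Gaussian matrix -/

/-- The linear map given by the columns of `H` indexed by `f`. -/
noncomputable def colMap {k d : ℕ} {J : Type*} [Fintype J] [DecidableEq J]
    (H : Matrix (Fin k) (Fin d) ℝ) (f : J → Fin d) :
    EuclideanSpace ℝ J →ₗ[ℝ] EuclideanSpace ℝ (Fin k) :=
  Matrix.toLpLin 2 2 (H.submatrix id f)

theorem colMap_apply {k d : ℕ} {J : Type*} [Fintype J] [DecidableEq J]
    (H : Matrix (Fin k) (Fin d) ℝ)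
    (f : J → Fin d) (u : EuclideanSpace ℝ J) (i : Fin k) :
    colMap H f u i = ∑ j, H i (f j) * u j := by
  simp [colMap, Matrix.toLpLin_apply, Matrix.mulVec, dotProduct]

/-- Union bound over a finite set. -/
theorem measureReal_exists_mem_le {Ω α : Type*} [MeasurableSpace Ω]
    {P : Measure Ω} (N : Finset α) {bad : α → Ω → Prop} {b : ℝ}
    (h : ∀ w ∈ N, P.real {ω | bad w ω} ≤ b) :
    P.real {ω | ∃ w ∈ N, bad w ω} ≤ N.card * b := by
  have : {ω | ∃ w ∈ N, bad w ω} = ⋃ w ∈ N, {ω | bad w ω} := by ext; simp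
  rw [this]
  refine (measureReal_biUnion_finset_le _ _).trans ((Finset.sum_le_sum h).trans ?_)
  simp

/-- The failure probability left after a union bound over a net. -/
theorem net_failure_le (n : ℕ) {ℓ : ℕ} (hℓ : 1 ≤ ℓ) :
    (5 : ℝ) ^ n * (2 * Real.exp (-(6 * (n + ℓ)))) ≤ 1 / 60 * (1 / 2) ^ ℓ := by
  have he : (240 : ℝ) ≤ Real.exp 6 := by
    have h1 : (2.7 : ℝ) ≤ Real.exp 1 := by linarith [Real.exp_one_gt_d9]
    have h2 : Real.exp 6 = Real.exp 1 ^ 6 := by rw [← Real.exp_nat_mul]; norm_num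
    rw [h2]
    calc (240 : ℝ) ≤ 2.7 ^ 6 := by norm_num
      _ ≤ _ := by gcongr
  have hq : Real.exp (-6) ≤ 1 / 240 := by
    rw [Real.exp_neg, ← one_div]
    exact one_div_le_one_div_of_le (by norm_num) he
  have hsplit : Real.exp (-(6 * ((n : ℝ) + ℓ))) = Real.exp (-6) ^ n * Real.exp (-6) ^ ℓ := by
    rw [← Real.exp_nat_mul, ← Real.exp_nat_mul, ← Real.exp_add]
    congr 1
    ring
  have hn : (5 * Real.exp (-6)) ^ n ≤ 1 := pow_le_one₀ (by positivity) (by linarith)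
  have hl : Real.exp (-6) ^ ℓ ≤ (1 / 2) ^ ℓ * (1 / 120) := by
    calc Real.exp (-6) ^ ℓ ≤ (1 / 240) ^ ℓ := by gcongr
      _ = (1 / 2) ^ ℓ * (1 / 120) ^ ℓ := by rw [← mul_pow]; norm_num
      _ ≤ (1 / 2) ^ ℓ * (1 / 120) ^ 1 := by
        gcongr ?_ * ?_
        exact pow_le_pow_of_le_one (by norm_num) (by norm_num) hℓ
      _ = _ := by rw [pow_one]
  calc (5 : ℝ) ^ n * (2 * Real.exp (-(6 * (n + ℓ))))
      = (5 * Real.exp (-6)) ^ n * (2 * Real.exp (-6) ^ ℓ) := by rw [hsplit, mul_pow]; ring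
    _ ≤ 1 * (2 * ((1 / 2) ^ ℓ * (1 / 120))) := by gcongr
    _ = _ := by ring

section Gaussian

variable {Ω : Type*} [MeasurableSpace Ω] {P : Measure Ω} [IsProbabilityMeasure P] {k d : ℕ}
  {G : Ω → Matrix (Fin k) (Fin d) ℝ}

/-- The image of a unit vector under a Gaussian matrix has independent Gaussian coordinates. -/
theorem IsGaussianSketch.colMap_unit {J : Type*} [Fintype J] [DecidableEq J]
    (hG : IsGaussianSketch P G)
    {f : J → Fin d} (hf : Function.Injective f) {u : EuclideanSpace ℝ J} (hu : ‖u‖ = 1) :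
    (∀ i, HasLaw (fun ω => colMap (G ω) f u i) (gaussianReal 0 (1 / (k : ℝ≥0))) P) ∧
      iIndepFun (fun i ω => colMap (G ω) f u i) P := by
  -- Extension of `u` by zero turns a combination of selected columns into a combination of all
  -- columns.
  set e : Fin d → ℝ := Function.extend f u 0 with he
  have hef : ∀ j, e (f j) = u j := fun j => hf.extend_apply _ _ _
  have he0 : ∀ j, j ∉ Set.range f → e j = 0 := fun j hj => by
    rw [he, Function.extend_apply' _ _ _ (by simpa using hj)]; rfl
  have hsq : ∑ j, e j * e j = 1 := by
    rw [← Fintype.sum_of_injective f hf (fun j => u j * u j) _ (fun j hj => by simp [he0 j hj])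
      (fun j => by simp [hef])]
    have := EuclideanSpace.real_norm_sq_eq u
    rw [hu] at this
    simpa [sq] using this.symm
  have h := hG.linear (fun p i j => if i = p then e j else 0) 1 (fun p q => by
    rw [Finset.sum_eq_single p]
    · by_cases hpq : p = q
      · simp [hpq, hsq]
      · simp [hpq]
    · intro b _ hb
      simp [hb]
    · simp)
  have hfun : ∀ (ω : Ω) (p : Fin k),
      ∑ i, ∑ j, (if i = p then e j else 0) * G ω i j = colMap (G ω) f u p := by
    intro ω p
    rw [colMap_apply, Fintype.sum_of_injective f hf _ (fun j => e j * G ω p j)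
      (fun j hj => by simp [he0 j hj]) (fun j => by rw [hef, mul_comm])]
    rw [Finset.sum_eq_single p]
    · simp
    · intro b _ hb
      simp [hb]
    · simp
  simpa only [hfun, one_mul] using h

/-- The inner products of a fixed vector with distinct columns of a Gaussian matrix are
independent Gaussian variables. -/
theorem IsGaussianSketch.inner_columns {J : Type*} [Fintype J] [DecidableEq J]
    (hG : IsGaussianSketch P G) {f : J → Fin d} (hf : Function.Injective f) (a : Fin k → ℝ)
    (r : ℝ≥0) (hr : ∑ i, a i ^ 2 = r) :
    (∀ j, HasLaw (fun ω => ∑ i, a i * G ω i (f j)) (gaussianReal 0 (r * (1 / (k : ℝ≥0)))) P) ∧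
      iIndepFun (fun j ω => ∑ i, a i * G ω i (f j)) P := by
  have h := hG.linear (fun p i j => if j = f p then a i else 0) r (fun p q => by
    by_cases hpq : p = q
    · simp [hpq, ← hr, sq]
    · have : f q ≠ f p := fun h => hpq (hf h.symm)
      simp [hpq, this])
  simpa [ite_mul] using h

/-- Right multiplication by an orthogonal matrix preserves the Gaussian law. -/
theorem IsGaussianSketch.mul_orthogonal (hG : IsGaussianSketch P G) {U : Matrix (Fin d) (Fin d) ℝ}
    (hU : Uᵀ * U = 1) : IsGaussianSketch P (fun ω => G ω * U) := by
  have hU' : ∀ j l, ∑ m, U m j * U m l = if j = l then 1 else 0 := by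
    intro j l
    have := congrFun (congrFun hU j) l
    simpa [Matrix.mul_apply, Matrix.one_apply] using this
  have h := hG.linear (fun (p : Fin k × Fin d) i j => if i = p.1 then U j p.2 else 0) 1
    (fun p q => by
      rw [Finset.sum_eq_single p.1]
      · by_cases h1 : p.1 = q.1
        · simp [h1, hU', Prod.ext_iff]
        · simp [h1, Prod.ext_iff]
      · intro b _ hb
        simp [hb]
      · simp)
  have hfun : ∀ (ω : Ω) (p : Fin k × Fin d),
      ∑ i, ∑ j, (if i = p.1 then U j p.2 else 0) * G ω i j = (G ω * U) p.1 p.2 := by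
    intro ω p
    rw [Matrix.mul_apply, Finset.sum_eq_single p.1]
    · simp [mul_comm]
    · intro b _ hb
      simp [hb]
    · simp
  simp only [hfun, one_mul] at h
  exact ⟨fun i j => h.1 (i, j), h.2⟩

/-- Two-sided tail bound for the squared norm of the image of a unit vector. -/
theorem IsGaussianSketch.tail_norm_sq {J : Type*} [Fintype J] [DecidableEq J]
    (hG : IsGaussianSketch P G)
    (hk : 0 < k) {f : J → Fin d} (hf : Function.Injective f) {u : EuclideanSpace ℝ J}
    (hu : ‖u‖ = 1) {τ : ℝ} (h0 : 0 ≤ τ) (h1 : τ ≤ 1) :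
    P.real {ω | τ < |‖colMap (G ω) f u‖ ^ 2 - 1|} ≤ 2 * Real.exp (-(k * τ ^ 2 / 8)) := by
  obtain ⟨hlaw, hind⟩ := hG.colMap_unit hf hu
  have hk' : (0 : ℝ) < k := by exact_mod_cast hk
  have hv : ((1 / (k : ℝ≥0) : ℝ≥0) : ℝ) = 1 / k := by simp
  have habs : |τ / 4| ≤ 1 / 4 := by rw [abs_of_nonneg (by positivity)]; linarith
  -- Weight times variance is `s = τ / 4`, the minimizer of the exponent `k (2 s² - s τ)`.
  have hup := measureReal_le_sum_mul_sq_le hlaw hind (fun _ => k * τ / 4)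
    (fun _ => by
      rw [hv, show k * τ / 4 * (1 / k) = τ / 4 by field_simp]
      exact habs) (k * τ / 4 * (1 + τ))
  have hlo := measureReal_le_sum_mul_sq_le hlaw hind (fun _ => -(k * τ / 4))
    (fun _ => by
      rw [hv, show -(k * τ / 4) * (1 / k) = -(τ / 4) by field_simp, abs_neg]
      exact habs) (-(k * τ / 4) * (1 - τ))
  rw [hv, Finset.sum_const, Finset.card_univ, Fintype.card_fin, nsmul_eq_mul] at hup hlo
  have e1 : (k : ℝ) * (k * τ / 4 * (1 / k) + 2 * (k * τ / 4 * (1 / k)) ^ 2)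
      - k * τ / 4 * (1 + τ) = -(k * τ ^ 2 / 8) := by field_simp; ring
  have e2 : (k : ℝ) * (-(k * τ / 4) * (1 / k) + 2 * (-(k * τ / 4) * (1 / k)) ^ 2)
      - -(k * τ / 4) * (1 - τ) = -(k * τ ^ 2 / 8) := by field_simp; ring
  rw [e1] at hup
  rw [e2] at hlo
  refine (measureReal_mono (fun ω hω => ?_) (measure_ne_top _ _)).trans
    ((measureReal_union_le _ _).trans ((add_le_add hup hlo).trans (le_of_eq (two_mul _).symm)))
  simp only [Set.mem_ofPred_eq, Set.mem_union, ← Finset.mul_sum,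
    ← EuclideanSpace.real_norm_sq_eq] at hω ⊢
  have hkt : 0 ≤ k * τ / 4 := by positivity
  rcases lt_abs.1 hω with h | h
  · left
    exact mul_le_mul_of_nonneg_left (by linarith) hkt
  · right
    rw [neg_mul, neg_mul, neg_le_neg_iff]
    exact mul_le_mul_of_nonneg_left (by linarith) hkt

/-- With high probability the columns of a Gaussian matrix indexed by `J` form a near-isometry. -/
theorem IsGaussianSketch.near_isometry {J : Type*} [Fintype J] [DecidableEq J]
    (hG : IsGaussianSketch P G)
    {f : J → Fin d} (hf : Function.Injective f) {ℓ : ℕ} (hℓ : 1 ≤ ℓ)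
    (hk : 48 * ((Fintype.card J : ℝ) + ℓ) ≤ k) :
    P.real {ω | ¬ ∀ u, |‖colMap (G ω) f u‖ ^ 2 - ‖u‖ ^ 2| ≤
      32 * √(48 * (Fintype.card J + ℓ) / k) * ‖u‖ ^ 2} ≤ 1 / 60 * (1 / 2) ^ ℓ := by
  obtain ⟨N, hcard, hN1, hN⟩ := exists_finset_net (EuclideanSpace ℝ J)
  rw [finrank_euclideanSpace] at hcard
  set n := Fintype.card J with hn
  have hℓ' : (1 : ℝ) ≤ ℓ := by exact_mod_cast hℓ
  have hk' : (0 : ℝ) < k := by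
    have : (0 : ℝ) ≤ n := by positivity
    linarith
  -- Chosen so that `k τ² / 8 = 6 (n + ℓ)`, which beats the net size `5 ^ n` in `net_failure_le`.
  set τ := √(48 * ((n : ℝ) + ℓ) / k) with hτ
  have h1 : τ ≤ 1 := by
    rw [hτ, Real.sqrt_le_one, div_le_one hk']
    exact hk
  have hexp : k * τ ^ 2 / 8 = 6 * ((n : ℝ) + ℓ) := by
    rw [hτ, Real.sq_sqrt (by positivity)]
    field_simp
    norm_num
  have hbad := measureReal_exists_mem_le (P := P) N
    (bad := fun w ω => τ < |‖colMap (G ω) f w‖ ^ 2 - 1|)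
    fun w hw => hG.tail_norm_sq (by exact_mod_cast hk') hf (hN1 w hw) (Real.sqrt_nonneg _) h1
  rw [hexp] at hbad
  have hcard' : (N.card : ℝ) ≤ 5 ^ n := by exact_mod_cast hcard
  refine (measureReal_mono (fun ω hω => ?_) (measure_ne_top _ _)).trans
    (hbad.trans ((mul_le_mul_of_nonneg_right hcard' (by positivity)).trans (net_failure_le n hℓ)))
  by_contra hgood
  simp only [Set.mem_ofPred_eq, not_exists, not_and, not_lt] at hgood
  exact hω fun u => abs_norm_sq_sub_le_of_net hN1 hN _ hgood u

/-- Tail bound for the weighted correlations of the columns outside `J` with the image of a fixed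
vector under the columns in `J`. -/
theorem IsGaussianSketch.tail_cross (hG : IsGaussianSketch P G) (hk : 0 < k) (J : Finset (Fin d))
    (u : EuclideanSpace ℝ J) {σ : Fin d → ℝ} {lam t : ℝ} (hlam : 0 < lam) (hσ : ∀ j, 0 ≤ σ j)
    (hσJ : ∀ j ∉ J, σ j ≤ lam / 16) (ht : ∑ j : {j // j ∉ J}, σ j ≤ t) (T : ℝ) :
    P.real {ω | ‖colMap (G ω) (Subtype.val : J → Fin d) u‖ ^ 2 ≤ 4 ∧
      T ≤ ∑ j : {j // j ∉ J}, σ j *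
        (∑ i, colMap (G ω) (Subtype.val : J → Fin d) u i * G ω i j) ^ 2} ≤
      Real.exp ((6 * t - k * T) / lam) := by
  have hk' : (0 : ℝ) < k := by exact_mod_cast hk
  have hmeas : ∀ e : Fin k × Fin d, AEMeasurable (fun ω => G ω e.1 e.2) P :=
    fun e => (hG.law e.1 e.2).aemeasurable
  set X : Ω → Fin k → ℝ := fun ω i => ∑ j : J, G ω i j * u j with hX
  set Y : Ω → Fin k × {j // j ∉ J} → ℝ := fun ω q => G ω q.1 q.2 with hY
  have hXm : AEMeasurable X P := aemeasurable_pi_lambda _ fun i =>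
    Finset.aemeasurable_fun_sum _ fun j _ => (hmeas (i, j)).mul_const _
  have hYm : AEMeasurable Y P := aemeasurable_pi_lambda _ fun q => hmeas (q.1, q.2)
  -- `X` depends only on entries in columns of `J` and `Y` only on the others, so `X` can be frozen
  -- below.
  have hXY : IndepFun X Y P := by
    have h := hG.indep.indepFun_finset₀ (Finset.univ.filter fun e : Fin k × Fin d => e.2 ∈ J)
      (Finset.univ.filter fun e : Fin k × Fin d => e.2 ∉ J)
      (Finset.disjoint_filter_filter_not _ _ _) hmeas
    let φ : ((Finset.univ.filter fun e : Fin k × Fin d => e.2 ∈ J) → ℝ) → Fin k → ℝ :=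
      fun x i => ∑ j : J, x ⟨(i, j), by simp⟩ * u j
    let ψ : ((Finset.univ.filter fun e : Fin k × Fin d => e.2 ∉ J) → ℝ) →
        Fin k × {j // j ∉ J} → ℝ := fun y q => y ⟨(q.1, q.2), by simpa using q.2.2⟩
    have hφ : Measurable φ := measurable_pi_lambda _ fun i =>
      Finset.measurable_fun_sum _ fun j _ => (measurable_pi_apply _).mul_const _
    have hψ : Measurable ψ := measurable_pi_lambda _ fun q => measurable_pi_apply _
    exact h.comp hφ hψ
  set K : Set ((Fin k → ℝ) × (Fin k × {j // j ∉ J} → ℝ)) :=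
    {z | ∑ i, z.1 i ^ 2 ≤ 4} ∩
      {z | T ≤ ∑ j : {j // j ∉ J}, σ j * (∑ i, z.1 i * z.2 (i, j)) ^ 2} with hK
  have hKm : MeasurableSet K :=
    (measurableSet_le (by fun_prop) measurable_const).inter
      (measurableSet_le measurable_const (by fun_prop))
  have hset : {ω | ‖colMap (G ω) (Subtype.val : J → Fin d) u‖ ^ 2 ≤ 4 ∧
      T ≤ ∑ j : {j // j ∉ J}, σ j *
        (∑ i, colMap (G ω) (Subtype.val : J → Fin d) u i * G ω i j) ^ 2}
      = {ω | (X ω, Y ω) ∈ K} := by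
    ext ω
    simp only [Set.mem_ofPred_eq, hK, Set.mem_inter_iff, EuclideanSpace.real_norm_sq_eq,
      colMap_apply, hX, hY]
  rw [hset]
  refine measureReal_pair_le_of_indepFun hXm hYm hXY hKm (Real.exp_pos _).le fun a => ?_
  by_cases ha : ∑ i, a i ^ 2 ≤ 4
  swap
  · have : {ω | (a, Y ω) ∈ K} = ∅ := by
      ext ω
      simp [hK, ha]
    rw [this, measureReal_empty]
    positivity
  set r : ℝ≥0 := ⟨∑ i, a i ^ 2, by positivity⟩ with hr
  have hr4 : (r : ℝ) ≤ 4 := ha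
  obtain ⟨hlaw, hind⟩ := hG.inner_columns (f := (Subtype.val : {j // j ∉ J} → Fin d))
    Subtype.val_injective a r rfl
  have hv : ∀ x : ℝ, k / lam * x * ((r * (1 / (k : ℝ≥0)) : ℝ≥0) : ℝ) = x * r / lam := by
    intro x
    push_cast
    field_simp
  have hbd : ∀ j : {j // j ∉ J}, σ j * r / lam ≤ 1 / 4 := by
    intro j
    rw [div_le_iff₀ hlam]
    have := hσJ j j.2
    have := hσ j
    nlinarith [r.2]
  have hnn : ∀ j : {j // j ∉ J}, 0 ≤ σ j * r / lam := fun j => by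
    have := hσ j
    positivity
  -- With variance `r / k`, `r ≤ 4` and `σ j ≤ lam / 16`, the scale `k / lam` is the largest for
  -- which these bounds guarantee the Chernoff condition `1/4`.
  have h := measureReal_le_sum_mul_sq_le hlaw hind (fun j => k / lam * σ j)
    (fun j => by rw [hv, abs_of_nonneg (hnn j)]; exact hbd j) (k / lam * T)
  simp only [hv] at h
  have hsum : ∑ j : {j // j ∉ J}, (σ j * r / lam + 2 * (σ j * r / lam) ^ 2) ≤ 6 * t / lam := by
    calc ∑ j : {j // j ∉ J}, (σ j * r / lam + 2 * (σ j * r / lam) ^ 2)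
        ≤ ∑ j : {j // j ∉ J}, 6 / lam * σ j := by
          refine Finset.sum_le_sum fun j _ => ?_
          have h1 : σ j * r / lam ≤ 4 / lam * σ j := by
            rw [div_mul_eq_mul_div]
            gcongr ?_ / _
            nlinarith [hσ j]
          have h2 : 6 / lam * σ j = 3 / 2 * (4 / lam * σ j) := by ring
          nlinarith [hbd j, hnn j]
      _ = 6 / lam * ∑ j : {j // j ∉ J}, σ j := by rw [Finset.mul_sum]
      _ ≤ 6 / lam * t := by gcongr
      _ = _ := by ring
  calc P.real {ω | (a, Y ω) ∈ K}
      ≤ P.real {ω | k / lam * T ≤ ∑ j : {j // j ∉ J},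
          k / lam * σ j * (∑ i, a i * G ω i j) ^ 2} := by
        refine measureReal_mono (fun ω hω => ?_) (measure_ne_top _ _)
        have h1 := hω.2
        simp only [Set.mem_ofPred_eq, hY] at h1 ⊢
        simp_rw [mul_assoc (k / lam : ℝ)]
        rw [← Finset.mul_sum]
        gcongr
    _ ≤ _ := h
    _ ≤ Real.exp ((6 * t - k * T) / lam) := by
        rw [Real.exp_le_exp, sub_div, mul_div_right_comm (k : ℝ) T lam]
        gcongr

/-- With high probability the weighted correlations of the columns outside `J` with the span of
the columns in `J` are uniformly small. -/
theorem IsGaussianSketch.cross_bound (hG : IsGaussianSketch P G) (hk : 0 < k)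
    (J : Finset (Fin d)) {σ : Fin d → ℝ} {lam t T : ℝ} (hlam : 0 < lam) (hσ : ∀ j, 0 ≤ σ j)
    (hσJ : ∀ j ∉ J, σ j ≤ lam / 16) (ht : ∑ j : {j // j ∉ J}, σ j ≤ t) {ℓ : ℕ} (hℓ : 1 ≤ ℓ)
    (hT : 6 * ((J.card : ℝ) + ℓ) * lam ≤ k * T - 6 * t) :
    P.real {ω | ¬ ((∀ u, ‖colMap (G ω) (Subtype.val : J → Fin d) u‖ ^ 2 ≤ 4 * ‖u‖ ^ 2) →
      ∀ u, ∑ j : {j // j ∉ J}, σ j *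
        (∑ i, colMap (G ω) (Subtype.val : J → Fin d) u i * G ω i j) ^ 2 ≤ 4 * T * ‖u‖ ^ 2)} ≤
      1 / 60 * (1 / 2) ^ ℓ := by
  obtain ⟨N, hcard, hN1, hN⟩ := exists_finset_net (EuclideanSpace ℝ J)
  rw [finrank_euclideanSpace, Fintype.card_coe] at hcard
  have hbad := measureReal_exists_mem_le (P := P) N
    (fun w _ => hG.tail_cross hk J w hlam hσ hσJ ht T)
  have hcard' : (N.card : ℝ) ≤ 5 ^ J.card := by exact_mod_cast hcard
  have hexp : Real.exp ((6 * t - k * T) / lam) ≤ 2 * Real.exp (-(6 * ((J.card : ℝ) + ℓ))) := by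
    have h1 : (6 * t - k * T) / lam ≤ -(6 * ((J.card : ℝ) + ℓ)) := by
      rw [div_le_iff₀ hlam]
      linarith
    have h2 := Real.exp_le_exp.2 h1
    have h3 := Real.exp_pos (-(6 * ((J.card : ℝ) + ℓ)))
    linarith
  refine (measureReal_mono (fun ω hω => ?_) (measure_ne_top _ _)).trans
    (hbad.trans ((mul_le_mul hcard' hexp (by positivity) (by positivity)).trans
      (net_failure_le J.card hℓ)))
  by_contra hgood
  simp only [Set.mem_ofPred_eq, not_exists, not_and, not_le] at hgood
  refine hω fun hle u => ?_
  -- The weighted sum of squared correlations is the squared norm of a linear map in `u`, so the net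
  -- argument applies.
  set B : Matrix {j // j ∉ J} (Fin k) ℝ := Matrix.of fun j i => √(σ j) * G ω i j with hB
  set S : EuclideanSpace ℝ J →ₗ[ℝ] EuclideanSpace ℝ {j // j ∉ J} :=
    Matrix.toLpLin 2 2 B ∘ₗ colMap (G ω) (Subtype.val : J → Fin d) with hS
  have hSn : ∀ u, ‖S u‖ ^ 2 = ∑ j : {j // j ∉ J}, σ j *
      (∑ i, colMap (G ω) (Subtype.val : J → Fin d) u i * G ω i j) ^ 2 := by
    intro u
    rw [EuclideanSpace.real_norm_sq_eq]
    refine Finset.sum_congr rfl fun j _ => ?_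
    have : S u j = √(σ j) * ∑ i, colMap (G ω) (Subtype.val : J → Fin d) u i * G ω i j := by
      simp only [hS, hB, LinearMap.comp_apply, Matrix.toLpLin_apply, Matrix.mulVec, dotProduct,
        Matrix.of_apply, Finset.mul_sum]
      exact Finset.sum_congr rfl fun i _ => by ring
    rw [this, mul_pow, Real.sq_sqrt (hσ j)]
  rw [← hSn]
  refine norm_sq_le_of_net hN S (fun w hw => ?_) u
  rw [hSn]
  refine (hgood w hw ?_).le
  have := hle w
  rwa [hN1 w hw, one_pow, mul_one] at this

end Gaussian

theorem sum_mem_add_sum_notMem {α : Type*} [Fintype α] [DecidableEq α] (J : Finset α)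
    (g : α → ℝ) : ∑ j : J, g j + ∑ j : {j // j ∉ J}, g j = ∑ j, g j := by
  rw [Finset.sum_coe_sort J g, ← Finset.sum_subtype Jᶜ (by simp) g, Finset.sum_add_sum_compl]

/-- Combination of the bounds for the columns with large weights, those with small weights, and
their correlations. -/
theorem weighted_norm_sq_le {k d : ℕ} {H : Matrix (Fin k) (Fin d) ℝ} (J : Finset (Fin d))
    {σ : Fin d → ℝ} {lam κ T : ℝ} (hlam : 0 ≤ lam) (hκ : 0 ≤ κ) (hT : 0 ≤ T)
    (hσ : ∀ j, 0 ≤ σ j) (hσl : ∀ j, σ j ≤ lam) (hσJ : ∀ j ∉ J, σ j ≤ lam / 16)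
    (h1 : ∀ u, ‖colMap H (Subtype.val : J → Fin d) u‖ ^ 2 ≤ (1 + κ) * ‖u‖ ^ 2)
    (h2 : ∀ u, ‖colMap H (Subtype.val : {j // j ∉ J} → Fin d) u‖ ^ 2 ≤ 4 * ‖u‖ ^ 2)
    (h3 : ∀ u, ∑ j : {j // j ∉ J}, σ j *
      (∑ i, colMap H (Subtype.val : J → Fin d) u i * H i j) ^ 2 ≤ 4 * T * ‖u‖ ^ 2)
    (v : Fin d → ℝ) :
    ∑ i, (∑ j, H i j * (√(σ j) * v j)) ^ 2 ≤ (lam + κ * lam + 8 * T) * ∑ j, v j ^ 2 := by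
  set u : EuclideanSpace ℝ J := WithLp.toLp 2 fun j => √(σ j) * v j with hu
  set w : EuclideanSpace ℝ {j // j ∉ J} := WithLp.toLp 2 fun j => √(σ j) * v j with hw
  set Y := colMap H (Subtype.val : J → Fin d) u with hY
  set Z := colMap H (Subtype.val : {j // j ∉ J} → Fin d) w with hZ
  set a := ∑ j : J, v j ^ 2 with ha
  set b := ∑ j : {j // j ∉ J}, v j ^ 2 with hb
  have ha0 : 0 ≤ a := by positivity
  have hb0 : 0 ≤ b := by positivity
  have hab : ∑ j, v j ^ 2 = a + b :=
    (sum_mem_add_sum_notMem J fun j => v j ^ 2).symm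
  have hlhs : ∑ i, (∑ j, H i j * (√(σ j) * v j)) ^ 2 = ‖Y + Z‖ ^ 2 := by
    rw [EuclideanSpace.real_norm_sq_eq]
    refine Finset.sum_congr rfl fun i _ => ?_
    rw [PiLp.add_apply, hY, hZ, colMap_apply, colMap_apply]
    exact congrArg (· ^ 2)
      (sum_mem_add_sum_notMem J fun j => H i j * (√(σ j) * v j)).symm
  have hun : ‖u‖ ^ 2 ≤ lam * a := by
    rw [EuclideanSpace.real_norm_sq_eq, ha, Finset.mul_sum]
    refine Finset.sum_le_sum fun j _ => ?_
    change (√(σ j) * v j) ^ 2 ≤ _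
    rw [mul_pow, Real.sq_sqrt (hσ j)]
    exact mul_le_mul_of_nonneg_right (hσl j) (sq_nonneg _)
  have hwn : ‖w‖ ^ 2 ≤ lam / 16 * b := by
    rw [EuclideanSpace.real_norm_sq_eq, hb, Finset.mul_sum]
    refine Finset.sum_le_sum fun j _ => ?_
    change (√(σ j) * v j) ^ 2 ≤ _
    rw [mul_pow, Real.sq_sqrt (hσ j)]
    exact mul_le_mul_of_nonneg_right (hσJ j j.2) (sq_nonneg _)
  have hin : inner ℝ Y Z = ∑ j : {j // j ∉ J}, v j * (√(σ j) * ∑ i, Y i * H i j) := by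
    rw [PiLp.inner_apply]
    simp only [hZ, colMap_apply, RCLike.inner_apply, conj_trivial, Finset.mul_sum, Finset.sum_mul]
    rw [Finset.sum_comm]
    refine Finset.sum_congr rfl fun j _ => Finset.sum_congr rfl fun i _ => ?_
    change H i j * (√(σ j) * v j) * Y i = _
    ring
  have hcs : (inner ℝ Y Z) ^ 2 ≤ b * (4 * T * (lam * a)) := by
    rw [hin]
    refine (Finset.sum_mul_sq_le_sq_mul_sq _ _ _).trans ?_
    rw [← hb]
    refine mul_le_mul_of_nonneg_left ?_ hb0
    simp_rw [mul_pow, Real.sq_sqrt (hσ _)]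
    exact (h3 u).trans (mul_le_mul_of_nonneg_left hun (by positivity))
  -- AM-GM, weighted so that the share `lam / 2` of `b`, added to the `lam / 4` from `‖Z‖ ^ 2`,
  -- stays below `lam`.
  have hcross : 2 * inner ℝ Y Z ≤ 8 * T * a + lam / 2 * b := by
    refine (abs_le_of_sq_le_sq' ?_ (by positivity)).2
    nlinarith [sq_nonneg (8 * T * a - lam / 2 * b)]
  have hYn : ‖Y‖ ^ 2 ≤ (1 + κ) * (lam * a) :=
    (h1 u).trans (mul_le_mul_of_nonneg_left hun (by positivity))
  have hZn : ‖Z‖ ^ 2 ≤ lam / 4 * b := by linarith [h2 w]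
  rw [hlhs, norm_add_sq_real, hab]
  have : 0 ≤ (κ * lam + 8 * T + lam / 4) * b := by positivity
  nlinarith

end SketchedEig

namespace SketchedEig

/-! ### The weighted sketch -/

/-- With probability at least `1 - 2^{-ℓ}/20`, the Gaussian matrix with columns scaled by `√σ j` has
squared operator norm at most `lam + O(1/√k)`. -/
theorem IsGaussianSketch.weighted_bound {Ω : Type*} [MeasurableSpace Ω] {P : Measure Ω}
    [IsProbabilityMeasure P] {k d ℓ : ℕ} {G : Ω → Matrix (Fin k) (Fin d) ℝ}
    (hG : IsGaussianSketch P G) (hℓ : 1 ≤ ℓ) (hd : ℓ ≤ d) (hk : 11000 * (d : ℝ) ≤ k)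
    {σ : Fin d → ℝ} {lam : ℝ} (hσ : ∀ j, 0 ≤ σ j) (hσl : ∀ j, σ j ≤ lam)
    (hσ2 : ∑ j, σ j ^ 2 ≤ 1) (hlam : 0 ≤ lam) (hℓlam : ℓ * lam ^ 2 ≤ 1) :
    P.real {ω | ¬ ∀ v : Fin d → ℝ, ∑ i, (∑ j, G ω i j * (√(σ j) * v j)) ^ 2 ≤
      (lam + 5000 / √k) * ∑ j, v j ^ 2} ≤ 1 / 20 * (1 / 2) ^ ℓ := by
  have hℓ' : (1 : ℝ) ≤ ℓ := by exact_mod_cast hℓ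
  have hd' : (ℓ : ℝ) ≤ d := by exact_mod_cast hd
  have hk0 : (0 : ℝ) < k := by linarith
  have hsk : 0 < √(k : ℝ) := Real.sqrt_pos.2 hk0
  -- The case `lam = 0` is separate because the cross-term Chernoff parameter is `k / lam`; all
  -- weights then vanish.
  rcases hlam.eq_or_lt with h0 | hpos
  · have hz : ∀ j, σ j = 0 := fun j => le_antisymm (h0 ▸ hσl j) (hσ j)
    have : {ω | ¬ ∀ v : Fin d → ℝ, ∑ i, (∑ j, G ω i j * (√(σ j) * v j)) ^ 2 ≤
        (lam + 5000 / √k) * ∑ j, v j ^ 2} = ∅ := by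
      ext ω
      simp only [Set.mem_ofPred_eq, Set.mem_empty_iff_false, iff_false, not_not]
      intro v
      simp only [hz, Real.sqrt_zero, zero_mul, mul_zero, Finset.sum_const_zero,
        zero_pow two_ne_zero]
      positivity
    rw [this, measureReal_empty]
    positivity
  set J : Finset (Fin d) := Finset.univ.filter fun j => lam / 16 < σ j with hJ
  have hσJ : ∀ j ∉ J, σ j ≤ lam / 16 := fun j hj => by simpa [hJ] using hj
  have hnd : (J.card : ℝ) ≤ d := by
    exact_mod_cast (Finset.card_le_univ J).trans (Fintype.card_fin d).le
  have hnlam : J.card * lam ^ 2 ≤ 256 := by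
    have h1 : ∑ j ∈ J, (lam / 16) ^ 2 ≤ ∑ j, σ j ^ 2 :=
      (Finset.sum_le_sum fun j hj => by
        have : lam / 16 < σ j := by simpa [hJ] using hj
        gcongr).trans (Finset.sum_le_univ_sum_of_nonneg fun j => sq_nonneg _)
    rw [Finset.sum_const, nsmul_eq_mul] at h1
    linarith
  have hcd : ((Fintype.card {j // j ∉ J} : ℕ) : ℝ) ≤ d := by
    exact_mod_cast (Fintype.card_subtype_le _).trans (Fintype.card_fin d).le
  -- The source of `11000`: since `n + ℓ ≤ 2d`, the bound needs `k ≥ 96 · 1024 / 9 · d`, slightly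
  -- under `11000 d`. Distortion `3` gives the squared norm bound `4`.
  have hsmall : ∀ n : ℝ, n ≤ d → 32 * √(48 * (n + ℓ) / k) ≤ 3 := by
    intro n hn
    have : √(48 * (n + ℓ) / k) ≤ 3 / 32 := by
      rw [Real.sqrt_le_left (by norm_num), div_le_iff₀ hk0]
      linarith
    linarith
  have hA := hG.near_isometry (f := (Subtype.val : J → Fin d)) Subtype.val_injective hℓ
    (by rw [Fintype.card_coe]; linarith)
  rw [Fintype.card_coe] at hA
  have hAc := hG.near_isometry (f := (Subtype.val : {j // j ∉ J} → Fin d))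
    Subtype.val_injective hℓ (by linarith)
  have hsum : ∑ j : {j // j ∉ J}, σ j ≤ √d := by
    have h1 : ∑ j : {j // j ∉ J}, σ j ≤ ∑ j, σ j := by
      rw [← sum_mem_add_sum_notMem J σ]
      have : 0 ≤ ∑ j : J, σ j := Finset.sum_nonneg fun j _ => hσ j
      linarith
    refine h1.trans (Real.le_sqrt_of_sq_le ?_)
    have h2 := sq_sum_le_card_mul_sum_sq (s := Finset.univ) (f := σ)
    rw [Finset.card_univ, Fintype.card_fin] at h2
    nlinarith [(Nat.cast_nonneg d : (0 : ℝ) ≤ d)]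
  -- Here `108 = 6 · (16 + 1) + 6`, from `|J| * lam ≤ 16 √d`, `ℓ * lam ≤ √d` and `∑ σ j ≤ √d`.
  set T : ℝ := 108 * √d / k with hT
  have hB := hG.cross_bound (by exact_mod_cast hk0) J (T := T) hpos hσ hσJ hsum hℓ (by
    have h1 : J.card * lam ≤ 16 * √d := by
      refine (abs_le_of_sq_le_sq' ?_ (by positivity)).2
      rw [mul_pow, mul_pow, Real.sq_sqrt (by positivity)]
      nlinarith [(Nat.cast_nonneg J.card : (0 : ℝ) ≤ J.card)]
    have h2 : ℓ * lam ≤ √d := by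
      refine Real.le_sqrt_of_sq_le ?_
      nlinarith
    have h3 : k * T = 108 * √d := by rw [hT]; field_simp
    rw [h3]
    linarith)
  set κ : ℝ := 32 * √(48 * (J.card + ℓ) / k) with hκ
  have hκlam : κ * lam ≤ 3584 / √k := by
    -- `(|J| + ℓ) * lam² ≤ 257` and `48 · 257 ≤ 112²`.
    have h1 : √(48 * (J.card + ℓ) / k) * lam ≤ 112 / √k := by
      refine (abs_le_of_sq_le_sq' ?_ (by positivity)).2
      rw [mul_pow, div_pow, Real.sq_sqrt (by positivity), Real.sq_sqrt hk0.le, div_mul_eq_mul_div]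
      gcongr ?_ / _
      linarith
    calc κ * lam = 32 * (√(48 * (J.card + ℓ) / k) * lam) := by rw [hκ]; ring
      _ ≤ 32 * (112 / √k) := by gcongr
      _ = _ := by ring
  have hTk : 8 * T ≤ 864 / √k := by
    have h1 : √d ≤ √(k : ℝ) := Real.sqrt_le_sqrt (by linarith)
    have h2 : √d / k ≤ 1 / √k := by
      rw [div_le_div_iff₀ hk0 hsk]
      calc √d * √k ≤ √k * √k := by gcongr
        _ = 1 * k := by rw [Real.mul_self_sqrt hk0.le, one_mul]
    calc 8 * T = 864 * (√d / k) := by rw [hT]; ring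
      _ ≤ 864 * (1 / √k) := by gcongr
      _ = _ := by ring
  have hcover : ∀ ω,
      (∀ u, |‖colMap (G ω) (Subtype.val : J → Fin d) u‖ ^ 2 - ‖u‖ ^ 2| ≤ κ * ‖u‖ ^ 2) →
      (∀ u, |‖colMap (G ω) (Subtype.val : {j // j ∉ J} → Fin d) u‖ ^ 2 - ‖u‖ ^ 2| ≤
        32 * √(48 * (Fintype.card {j // j ∉ J} + ℓ) / k) * ‖u‖ ^ 2) →
      ((∀ u, ‖colMap (G ω) (Subtype.val : J → Fin d) u‖ ^ 2 ≤ 4 * ‖u‖ ^ 2) →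
        ∀ u, ∑ j : {j // j ∉ J}, σ j *
          (∑ i, colMap (G ω) (Subtype.val : J → Fin d) u i * G ω i j) ^ 2 ≤ 4 * T * ‖u‖ ^ 2) →
      ∀ v : Fin d → ℝ, ∑ i, (∑ j, G ω i j * (√(σ j) * v j)) ^ 2 ≤
        (lam + 5000 / √k) * ∑ j, v j ^ 2 := by
    intro ω g1 g2 g3 v
    have h1 : ∀ u, ‖colMap (G ω) (Subtype.val : J → Fin d) u‖ ^ 2 ≤ (1 + κ) * ‖u‖ ^ 2 := by
      intro u
      linarith [(abs_le.1 (g1 u)).2]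
    have h2 : ∀ u, ‖colMap (G ω) (Subtype.val : {j // j ∉ J} → Fin d) u‖ ^ 2 ≤ 4 * ‖u‖ ^ 2 := by
      intro u
      have := mul_le_mul_of_nonneg_right (hsmall _ hcd) (sq_nonneg ‖u‖)
      linarith [(abs_le.1 (g2 u)).2]
    have h3 := g3 fun u => (h1 u).trans
      (mul_le_mul_of_nonneg_right (by linarith [hsmall _ hnd]) (sq_nonneg _))
    refine (weighted_norm_sq_le J hlam (by positivity) (by positivity) hσ hσl hσJ h1 h2 h3
      v).trans ?_
    have hone : 3584 / √(k : ℝ) + 864 / √k ≤ 5000 / √k := by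
      rw [← add_div]
      gcongr
      norm_num
    refine mul_le_mul_of_nonneg_right ?_ (Finset.sum_nonneg fun j _ => sq_nonneg _)
    linarith
  refine (measureReal_mono (fun ω hω => ?_) (measure_ne_top _ _)).trans
    ((measureReal_union_le _ _).trans
      ((add_le_add ((measureReal_union_le _ _).trans (add_le_add hA hAc)) hB).trans
        (le_of_eq (by ring))))
  by_contra hgood
  simp only [Set.mem_union, Set.mem_ofPred_eq, not_or, not_not] at hgood
  exact hω (hcover ω hgood.1.1 hgood.1.2 hgood.2)

/-- Passing from a bound on the columns to the bound for the transposed map. -/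
theorem sum_weighted_sq_le {k d : ℕ} {H : Matrix (Fin k) (Fin d) ℝ} {σ : Fin d → ℝ} {τ : ℝ}
    (hσ : ∀ j, 0 ≤ σ j) (hτ : 0 ≤ τ)
    (h : ∀ v : Fin d → ℝ, ∑ i, (∑ j, H i j * (√(σ j) * v j)) ^ 2 ≤ τ * ∑ j, v j ^ 2)
    (x : Fin k → ℝ) :
    ∑ j, σ j * (∑ i, x i * H i j) ^ 2 ≤ τ * ∑ i, x i ^ 2 := by
  set v : Fin d → ℝ := fun j => √(σ j) * ∑ i, x i * H i j with hv
  set Q := ∑ j, σ j * (∑ i, x i * H i j) ^ 2 with hQ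
  have hvQ : ∑ j, v j ^ 2 = Q :=
    Finset.sum_congr rfl fun j _ => by rw [hv, mul_pow, Real.sq_sqrt (hσ j)]
  have hxy : ∑ i, x i * ∑ j, H i j * (√(σ j) * v j) = Q := by
    rw [← hvQ]
    simp_rw [Finset.mul_sum]
    rw [Finset.sum_comm]
    refine Finset.sum_congr rfl fun j _ => ?_
    calc ∑ i, x i * (H i j * (√(σ j) * v j))
        = (√(σ j) * ∑ i, x i * H i j) * v j := by
          rw [Finset.mul_sum, Finset.sum_mul]
          exact Finset.sum_congr rfl fun i _ => by ring
      _ = v j ^ 2 := (sq (v j)).symm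
  have hx0 : 0 ≤ ∑ i, x i ^ 2 := by positivity
  -- With `M` the scaled matrix and `v = Mᵀ x`, one has `Q = ‖v‖² = ⟨x, M v⟩`; Cauchy–Schwarz and
  -- the bound on `M` give this, and one factor `Q` cancels.
  have hcs : Q * Q ≤ (τ * ∑ i, x i ^ 2) * Q := by
    have h1 := Finset.sum_mul_sq_le_sq_mul_sq Finset.univ x
      fun i => ∑ j, H i j * (√(σ j) * v j)
    rw [hxy] at h1
    have h2 := mul_le_mul_of_nonneg_left (h v) hx0
    rw [hvQ] at h2
    nlinarith
  have hQ0 : 0 ≤ Q := hvQ ▸ Finset.sum_nonneg fun j _ => sq_nonneg _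
  rcases hQ0.eq_or_lt with h0 | h0
  · rw [← h0]; positivity
  · exact le_of_mul_le_mul_right hcs h0

/-! ### Eigenvalues -/

section Eigenvalues

open Matrix

/-- The position of an eigenvector in the decreasing order of eigenvalues. -/
noncomputable def eigRank (n : ℕ) : Fin n ≃ Fin (Fintype.card (Fin n)) :=
  (Fintype.equivOfCardEq (Fintype.card_fin _)).symm

/-- `eigRank` repeats the equivalence through which `eigenvalues` is defined from `eigenvalues₀`, so
the equality is definitional. -/
theorem eigenvalues_eq_eigRank {n : ℕ} {A : Matrix (Fin n) (Fin n) ℝ} (hA : A.IsHermitian)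
    (j : Fin n) : hA.eigenvalues j = hA.eigenvalues₀ (eigRank n j) := rfl

/-- The index of the `m`-th largest eigenvalue, counted from `0`. -/
noncomputable def topIndex {n ℓ : ℕ} (h : ℓ ≤ n) (m : Fin ℓ) : Fin n :=
  (eigRank n).symm ⟨m, by rw [Fintype.card_fin]; omega⟩

theorem topIndex_injective {n ℓ : ℕ} (h : ℓ ≤ n) : Function.Injective (topIndex h) := by
  intro a b hab
  have := (eigRank n).symm.injective hab
  exact Fin.ext (by simpa using this)

theorem eig_le_eigenvalues_topIndex {n ℓ : ℕ} {A : Matrix (Fin n) (Fin n) ℝ}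
    (hA : A.IsHermitian) (h1 : 1 ≤ ℓ) (h : ℓ ≤ n) (m : Fin ℓ) :
    eig hA ℓ h1 h ≤ hA.eigenvalues (topIndex h m) := by
  rw [eigenvalues_eq_eigRank, topIndex, Equiv.apply_symm_apply, eig]
  apply hA.eigenvalues₀_antitone
  rw [Fin.mk_le_mk]
  omega

theorem eigenvalues_le_eig {n ℓ : ℕ} {A : Matrix (Fin n) (Fin n) ℝ}
    (hA : A.IsHermitian) (h1 : 1 ≤ ℓ) (h : ℓ ≤ n) {j : Fin n}
    (hj : ¬ (eigRank n j).val < ℓ - 1) : hA.eigenvalues j ≤ eig hA ℓ h1 h := by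
  rw [eigenvalues_eq_eigRank, eig]
  apply hA.eigenvalues₀_antitone
  rw [Fin.le_def]
  exact not_lt.1 hj

/-- Upper bound in the Courant–Fischer principle: if the quadratic form of `A` is at most `τ` on
the orthogonal complement of fewer than `ℓ` vectors, then `λ_ℓ(A) ≤ τ`. -/
theorem eig_le_of_forall_orthogonal {n ℓ : ℕ} {A : Matrix (Fin n) (Fin n) ℝ}
    (hA : A.IsHermitian) (h1 : 1 ≤ ℓ) (h : ℓ ≤ n) {S : Type*} [Fintype S]
    (hS : Fintype.card S < ℓ) (φ : S → Fin n → ℝ) {τ : ℝ}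
    (hτ : ∀ x : Fin n → ℝ, (∀ s, x ⬝ᵥ φ s = 0) → x ⬝ᵥ A *ᵥ x ≤ τ * ∑ i, x i ^ 2) :
    eig hA ℓ h1 h ≤ τ := by
  set b : Fin ℓ → EuclideanSpace ℝ (Fin n) := fun m => hA.eigenvectorBasis (topIndex h m) with hb
  have hbo : Orthonormal ℝ b :=
    hA.eigenvectorBasis.orthonormal.comp _ (topIndex_injective h)
  let L : (Fin ℓ → ℝ) →ₗ[ℝ] (S → ℝ) :=
    (Matrix.of φ).mulVecLin ∘ₗ (Matrix.of fun i m => b m i).mulVecLin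
  -- Dimension count: `ℓ` coefficients on the top eigenvectors against fewer than `ℓ` constraints
  -- leave a nonzero admissible `x`.
  have hker : LinearMap.ker L ≠ ⊥ := LinearMap.ker_ne_bot_of_finrank_lt (by simpa using hS)
  obtain ⟨c, hcL, hc0⟩ := Submodule.exists_mem_ne_zero_of_ne_bot hker
  set x : EuclideanSpace ℝ (Fin n) := ∑ m, c m • b m with hx
  have hxv : x.ofLp = (Matrix.of fun i m => b m i) *ᵥ c := by
    ext i
    simp [hx, Matrix.mulVec, dotProduct, mul_comm]
  have hortho : ∀ s, x.ofLp ⬝ᵥ φ s = 0 := by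
    intro s
    have := congrFun (LinearMap.mem_ker.1 hcL) s
    rw [hxv, dotProduct_comm]
    exact this
  set μ : Fin ℓ → ℝ := fun m => hA.eigenvalues (topIndex h m) with hμ
  have hAx : A *ᵥ x.ofLp = (∑ m, (μ m * c m) • b m : EuclideanSpace ℝ (Fin n)).ofLp := by
    have : x.ofLp = ∑ m, c m • (b m).ofLp := by simp [hx]
    rw [this, Matrix.mulVec_sum, WithLp.ofLp_sum]
    refine Finset.sum_congr rfl fun m _ => ?_
    rw [Matrix.mulVec_smul, hb, hA.mulVec_eigenvectorBasis, smul_smul, mul_comm]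
    rfl
  have hquad : x.ofLp ⬝ᵥ A *ᵥ x.ofLp = ∑ m, μ m * c m ^ 2 := by
    rw [hAx, dotProduct_comm]
    have h2 := hbo.inner_sum c (fun m => μ m * c m) Finset.univ
    rw [EuclideanSpace.inner_eq_star_dotProduct, star_trivial] at h2
    rw [h2]
    exact Finset.sum_congr rfl fun m _ => by simp only [conj_trivial]; ring
  have hnorm : ∑ i, x i ^ 2 = ∑ m, c m ^ 2 := by
    rw [← EuclideanSpace.real_norm_sq_eq, ← real_inner_self_eq_norm_sq, hx,
      hbo.inner_sum c c Finset.univ]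
    exact Finset.sum_congr rfl fun m _ => by simp only [conj_trivial]; ring
  have hpos : 0 < ∑ m, c m ^ 2 := by
    obtain ⟨m, hm⟩ := Function.ne_iff.1 hc0
    exact Finset.sum_pos' (fun _ _ => sq_nonneg _) ⟨m, Finset.mem_univ _, by
      have : c m ≠ 0 := hm
      positivity⟩
  have hmain := hτ x.ofLp hortho
  rw [hquad, hnorm] at hmain
  refine le_of_mul_le_mul_right (le_trans ?_ hmain) hpos
  rw [Finset.mul_sum]
  exact Finset.sum_le_sum fun m _ =>
    mul_le_mul_of_nonneg_right (eig_le_eigenvalues_topIndex hA h1 h m) (sq_nonneg _)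

/-- The orthogonal matrix of eigenvectors. -/
noncomputable def eigMatrix {n : ℕ} {A : Matrix (Fin n) (Fin n) ℝ} (hA : A.IsHermitian) :
    Matrix (Fin n) (Fin n) ℝ := hA.eigenvectorUnitary

theorem eigMatrix_transpose_mul {n : ℕ} {A : Matrix (Fin n) (Fin n) ℝ} (hA : A.IsHermitian) :
    (eigMatrix hA)ᵀ * eigMatrix hA = 1 := by
  have := Unitary.coe_star_mul_self hA.eigenvectorUnitary
  rwa [Matrix.star_eq_conjTranspose, Matrix.conjTranspose_eq_transpose_of_trivial] at this

theorem eq_eigMatrix_mul {n : ℕ} {A : Matrix (Fin n) (Fin n) ℝ} (hA : A.IsHermitian) :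
    A = eigMatrix hA * diagonal hA.eigenvalues * (eigMatrix hA)ᵀ := by
  have h := hA.spectral_theorem
  rw [Unitary.conjStarAlgAut_apply, Matrix.star_eq_conjTranspose,
    Matrix.conjTranspose_eq_transpose_of_trivial] at h
  exact h

open scoped Matrix.Norms.Frobenius in
theorem frobNorm_nonneg {m n : ℕ} (A : Matrix (Fin m) (Fin n) ℝ) : 0 ≤ frobNorm A :=
  norm_nonneg A

/-- Both sides are the trace of `A * A`, by symmetry of `A` and cyclicity of the trace in the
eigenbasis. -/
theorem sum_eigenvalues_sq {n : ℕ} {A : Matrix (Fin n) (Fin n) ℝ} (hA : A.IsHermitian) :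
    ∑ j, hA.eigenvalues j ^ 2 = frobNorm A ^ 2 := by
  have h1 : frobNorm A ^ 2 = (A * Aᵀ).trace := by
    rw [frobNorm, Matrix.frobenius_norm_def, ← Real.sqrt_eq_rpow, Real.sq_sqrt (by positivity)]
    simp [Matrix.trace, Matrix.mul_apply, sq]
  have hT : Aᵀ = A := by
    rw [← Matrix.conjTranspose_eq_transpose_of_trivial]
    exact hA
  set U := eigMatrix hA with hU
  set Λ : Matrix (Fin n) (Fin n) ℝ := diagonal hA.eigenvalues with hΛ
  have hUU : Uᵀ * U = 1 := eigMatrix_transpose_mul hA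
  have h2 : A * A = U * (Λ * Λ) * Uᵀ := by
    calc A * A = (U * Λ * Uᵀ) * (U * Λ * Uᵀ) := by rw [← eq_eigMatrix_mul hA]
      _ = U * Λ * (Uᵀ * U) * Λ * Uᵀ := by simp only [Matrix.mul_assoc]
      _ = _ := by rw [hUU, Matrix.mul_one]; simp only [Matrix.mul_assoc]
  rw [h1, hT, h2, Matrix.trace_mul_comm, ← Matrix.mul_assoc, hUU, Matrix.one_mul, hΛ,
    Matrix.diagonal_mul_diagonal, Matrix.trace_diagonal]
  exact Finset.sum_congr rfl fun j _ => sq _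

/-- The quadratic form of `G A Gᵀ` in terms of the eigenvalues of `A`. -/
theorem dotProduct_sketch {k n : ℕ} (G : Matrix (Fin k) (Fin n) ℝ) {A : Matrix (Fin n) (Fin n) ℝ}
    (hA : A.IsHermitian) (x : Fin k → ℝ) :
    x ⬝ᵥ (G * A * Gᵀ) *ᵥ x
      = ∑ j, hA.eigenvalues j * (∑ i, x i * (G * eigMatrix hA) i j) ^ 2 := by
  set H := G * eigMatrix hA with hH
  have h : G * A * Gᵀ = H * diagonal hA.eigenvalues * Hᵀ := by
    rw [hH, Matrix.transpose_mul]
    conv_lhs => rw [eq_eigMatrix_mul hA]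
    simp only [Matrix.mul_assoc]
  rw [h, ← Matrix.mulVec_mulVec, ← Matrix.mulVec_mulVec, Matrix.dotProduct_mulVec,
    Matrix.mulVec_transpose, dotProduct]
  refine Finset.sum_congr rfl fun j _ => ?_
  rw [Matrix.mulVec_diagonal]
  simp only [Matrix.vecMul, dotProduct]
  ring

/-- Deterministic reduction: a bound for the weighted sum over the eigenvectors of `A` beyond the
first `ℓ - 1`, with negative eigenvalues discarded, bounds `λ_ℓ(G A Gᵀ)`. -/
theorem eig_sketch_le {k n ℓ : ℕ} (G : Matrix (Fin k) (Fin n) ℝ) {A : Matrix (Fin n) (Fin n) ℝ}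
    (hA : A.IsHermitian) (h1 : 1 ≤ ℓ) (hk : ℓ ≤ k) {τ : ℝ}
    (hτ : ∀ x : Fin k → ℝ, ∑ j, (if (eigRank n j).val < ℓ - 1 then 0 else
      max (hA.eigenvalues j) 0) * (∑ i, x i * (G * eigMatrix hA) i j) ^ 2 ≤ τ * ∑ i, x i ^ 2) :
    eig (isHermitian_sketch G hA) ℓ h1 hk ≤ τ := by
  have hcard : Fintype.card {j : Fin n // (eigRank n j).val < ℓ - 1} < ℓ := by
    have := Fintype.card_le_of_injective
      (fun j : {j : Fin n // (eigRank n j).val < ℓ - 1} => (⟨_, j.2⟩ : Fin (ℓ - 1)))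
      (fun a b hab => Subtype.ext ((eigRank n).injective (Fin.ext (by simpa using hab))))
    have hfin := Fintype.card_fin (ℓ - 1)
    omega
  refine eig_le_of_forall_orthogonal _ h1 hk hcard
    (fun j i => (G * eigMatrix hA) i j) fun x hx => ?_
  refine le_trans ?_ (hτ x)
  rw [dotProduct_sketch G hA]
  refine Finset.sum_le_sum fun j _ => ?_
  split_ifs with hj
  -- The orthogonality constraints are exactly the vanishing of the terms of rank below `ℓ - 1`.
  · have : ∑ i, x i * (G * eigMatrix hA) i j = 0 := hx ⟨j, hj⟩
    simp [this]
  · exact mul_le_mul_of_nonneg_right (le_max_left _ _) (sq_nonneg _)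

end Eigenvalues

end SketchedEig

theorem mainTheorem2 :
    ∃ c C : ℝ, 0 < c ∧ 0 < C ∧
      ∀ (d k ℓ : ℕ) (ε : ℝ) (h1 : 1 ≤ ℓ) (hd : ℓ ≤ d), 0 < ε →
      c * ((d : ℝ) + 1 / ε ^ 2) ≤ (k : ℝ) →
      ∀ (D : Matrix (Fin d) (Fin d) ℝ) (hD : D.IsHermitian),
      SketchedEig.frobNorm D ≤ 1 →
      0 ≤ SketchedEig.eig hD ℓ h1 hd →
      ∀ (Ω : Type*) [MeasurableSpace Ω] (P : Measure Ω) [IsProbabilityMeasure P]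
        (G : Ω → Matrix (Fin k) (Fin d) ℝ), SketchedEig.IsGaussianSketch P G →
      ∃ hk : ℓ ≤ k,
        1 - (1 / 20) * (2 : ℝ) ^ (-min (ℓ : ℝ) (1 / ε ^ 2)) ≤
          P.real {ω | SketchedEig.eig (SketchedEig.isHermitian_sketch (G ω) hD) ℓ h1 hk ≤
            SketchedEig.eig hD ℓ h1 hd + C * ε} := by
  refine ⟨11000, 5000, by norm_num, by norm_num, ?_⟩
  intro d k ℓ ε h1 hd hε hk D hD hF hlam Ω _ P _ G hG
  have hε2 : 0 < 1 / ε ^ 2 := by positivity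
  have hd0 : (0 : ℝ) ≤ d := Nat.cast_nonneg d
  have hkd : 11000 * (d : ℝ) ≤ k := by linarith
  have hℓk : ℓ ≤ k := hd.trans (by exact_mod_cast (by linarith : (d : ℝ) ≤ k))
  refine ⟨hℓk, ?_⟩
  have hεk : 1 / √(k : ℝ) ≤ ε := by
    have h2 : 1 / ε ^ 2 ≤ k := by linarith
    have h3 : 1 / ε ≤ √(k : ℝ) := Real.le_sqrt_of_sq_le (by rwa [div_pow, one_pow])
    exact (one_div_le hε (lt_of_lt_of_le (by positivity) h3)).1 h3
  set lam := SketchedEig.eig hD ℓ h1 hd with hlamdef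
  set σ : Fin d → ℝ := fun j => if (SketchedEig.eigRank d j).val < ℓ - 1 then 0 else
    max (hD.eigenvalues j) 0 with hσdef
  have hμ2 : ∑ j, hD.eigenvalues j ^ 2 ≤ 1 := by
    rw [SketchedEig.sum_eigenvalues_sq hD]
    exact pow_le_one₀ (SketchedEig.frobNorm_nonneg D) hF
  have hσ : ∀ j, 0 ≤ σ j := fun j => by
    simp only [hσdef]
    split_ifs
    exacts [le_rfl, le_max_right _ _]
  have hσl : ∀ j, σ j ≤ lam := fun j => by
    simp only [hσdef]
    split_ifs with hj
    exacts [hlam, max_le (SketchedEig.eigenvalues_le_eig hD h1 hd hj) hlam]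
  have hσ2 : ∑ j, σ j ^ 2 ≤ 1 := by
    refine (Finset.sum_le_sum fun j _ => ?_).trans hμ2
    simp only [hσdef]
    split_ifs
    · rw [zero_pow two_ne_zero]
      exact sq_nonneg _
    · rw [sq_le_sq, abs_of_nonneg (le_max_right _ _)]
      exact max_le (le_abs_self _) (abs_nonneg _)
  -- The top `ℓ` eigenvalues are all at least `lam ≥ 0`, so their squares alone contribute `ℓ *
  -- lam²` to the squared Frobenius norm.
  have hℓlam : ℓ * lam ^ 2 ≤ 1 := by
    have h2 : ∑ _m : Fin ℓ, lam ^ 2 ≤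
        ∑ m : Fin ℓ, hD.eigenvalues (SketchedEig.topIndex hd m) ^ 2 :=
      Finset.sum_le_sum fun m _ =>
        pow_le_pow_left₀ hlam (SketchedEig.eig_le_eigenvalues_topIndex hD h1 hd m) 2
    rw [Finset.sum_const, Finset.card_univ, Fintype.card_fin, nsmul_eq_mul] at h2
    refine h2.trans (le_trans ?_ hμ2)
    rw [← Finset.sum_image (f := fun j => hD.eigenvalues j ^ 2)
      (SketchedEig.topIndex_injective hd).injOn]
    exact Finset.sum_le_univ_sum_of_nonneg fun j => sq_nonneg _
  have hbad := (hG.mul_orthogonal (SketchedEig.eigMatrix_transpose_mul hD)).weighted_bound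
    h1 hd hkd hσ hσl hσ2 hlam hℓlam
  set good := {ω | SketchedEig.eig (SketchedEig.isHermitian_sketch (G ω) hD) ℓ h1 hℓk ≤
    lam + 5000 * ε} with hgood
  have hcompl : P.real goodᶜ ≤ 1 / 20 * (1 / 2) ^ ℓ := by
    refine (measureReal_mono (fun ω hω => ?_) (measure_ne_top _ _)).trans hbad
    intro hv
    refine hω ?_
    have h2 := SketchedEig.eig_sketch_le (G ω) hD h1 hℓk
      (SketchedEig.sum_weighted_sq_le hσ (by positivity) hv)
    have h3 : 5000 / √(k : ℝ) ≤ 5000 * ε := by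
      rw [div_eq_mul_one_div]
      gcongr
    exact h2.trans (by linarith)
  -- Subadditivity suffices, so measurability of the event is not required.
  have htotal : 1 ≤ P.real good + P.real goodᶜ := by
    rw [← probReal_univ (μ := P), ← Set.union_compl_self good]
    exact measureReal_union_le _ _
  -- The argument gives the stronger failure bound `2^{-ℓ}`; the minimum only weakens it.
  have hpow : ((1 : ℝ) / 2) ^ ℓ ≤ (2 : ℝ) ^ (-min (ℓ : ℝ) (1 / ε ^ 2)) := by
    rw [one_div, inv_pow, ← Real.rpow_natCast, ← Real.rpow_neg zero_le_two]
    exact Real.rpow_le_rpow_of_exponent_le one_le_two (neg_le_neg (min_le_left _ _))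
  linarith
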